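/- **Key Lemma (probabilistic transformers memorize empirical Markov kernels).** *Definitions.* A ReLU network $\mathbb{R}^m\to\mathbb{R}^q$ of depth $J\ge 1$ with layer dimensions $d_0=m,d_1,\dots,d_J=q$ is a composition of $J$ affine maps $x\mapsto A^{(j)}x+b^{(j)}$, where $A^{(j)}\in\mathbb{R}^{d_j\times d_{j-1}}$ and $b^{(j)}\in\mathbb{R}^{d_j}$, with $t\mapsto\max\{0,t\}$ applied componentwise after every affine map except the last. Its number of parameters $\mathrm{par}$ is the number of nonzero entries of all the $A^{(j)}$ and $b^{(j)}$. Its width is the largest of its layer dimensions, input and output included; for a network with output in $\mathbb{R}^d\times\mathbb{R}^{d\times d}$, the two output vectors (of dimensions $d$ and $d^2$) are counted separately, i.e. the width is $\max\{d_0,\dots,d_{J-1},d,d^2\}$. A probabilistic transformer on a metric space $(\mathcal{X},\rho)$ with values in probability measures on $\mathbb{R}^d$ is a map $$T(x)=\sum_{k=1}^{K'}\frac{e^{w_k(x)}}{\sum_{i=1}^{K'}e^{w_i(x)}}\;N_d\big(m_k(x),S_k(x)^\top S_k(x)\big),$$ $$w(x)=\mathcal{NN}_w(u),\qquad (m_k(x),S_k(x))=\mathcal{NN}_k(u),\qquad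 u=(\rho(x,x_l))_{l=1}^{L},$$ given by integers $L,K'\ge1$, landmarks $x_1,\dots,x_L\in\mathcal{X}$, a ReLU network $\mathcal{NN}_w:\mathbb{R}^L\to\mathbb{R}^{K'}$ and ReLU networks $\mathcal{NN}_1,\dots,\mathcal{NN}_{K'}:\mathbb{R}^L\to\mathbb{R}^d\times\mathbb{R}^{d\times d}$. Here $N_d(m,\Sigma)$ is the Gaussian measure on $\mathbb{R}^d$ with mean $m$ and covariance $\Sigma$, so $N_d(m,0)$ is the point mass at $m$. The depth and the width of $T$ are the maxima of the depths and of the widths of $\mathcal{NN}_w,\mathcal{NN}_1,\dots,\mathcal{NN}_{K'}$; moreover $\mathrm{par}(T)=\mathrm{par}(\mathcal{NN}_w)+\sum_{k}\mathrm{par}(\mathcal{NN}_k)$ and $\mathrm{effdim}(T)=K'(d+d^2)$. For a finite metric space $\mathcal{X}_n$, $\operatorname{aspect}(\mathcal{X}_n)$ is the maximal distance between two points divided by the minimal distance between two distinct points. Let $(u)_+=\max\{u,1\}$ and $$C_n=\frac{2\log(5\sqrt{2\pi})+\frac32\log n-\frac12\log(n+1)}{2\log 2},$$ $$F(\mathcal{X}_n)=\sqrt{n\log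 n}\left[1+\frac{\log 2}{\log n}\left(C_n+\frac{\log\big(n^{5/2}\operatorname{aspect}(\mathcal{X}_n)\big)}{\log 2}\right)_+\right].$$ *Statement.* There is an absolute constant $C>0$ such that the following holds. Let $n>2$, $d\ge1$, $K\ge1$ be integers, let $\mathcal{X}_n$ be an $n$-point metric space, let $\mu_1,\dots,\mu_K:\mathcal{X}_n\to\mathbb{R}^d$ be arbitrary maps, and put $$\varphi(x)=\frac1K\sum_{k=1}^K N_d(\mu_k(x),0).$$ Then there is a probabilistic transformer $T$ on $\mathcal{X}_n$ with values in probability measures on $\mathbb{R}^d$ such that $T(x)=\varphi(x)$ for every $x\in\mathcal{X}_n$ and $$\mathrm{width}(T)=\max\{n,\;K,\;d^2,\;n(n-1)+\max\{d,12\}\},$$ $$\mathrm{depth}(T)\le C\,n\,\{1+F(\mathcal{X}_n)\},$$ $$\mathrm{effdim}(T)\le K(d+d^2),$$ $$\mathrm{par}(T)\le C\,K\,n\left(\tfrac{11}{4}\max\{n,d\}\,n^2-1\right)\left\{d+\max\{d,12\}^2\,F(\mathcal{X}_n)\right\}.$$ -/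

import Mathlib

open MeasureTheory ProbabilityTheory
open scoped ENNReal Matrix

noncomputable section

/-- The rectified linear unit. -/
def relu (t : ℝ) : ℝ := max 0 t

/-- The parameters of a deep feedforward ReLU network with input space `ℝ^m` and output space `ℝ^ι`:
a finite nonempty sequence of affine layers, with the componentwise ReLU applied after every layer
except the last one. -/
inductive ReLUNet (ι : Type) : ℕ → Type
  | last {m : ℕ} (A : Matrix ι (Fin m) ℝ) (b : ι → ℝ) : ReLUNet ι m
  | layer {m h : ℕ} (A : Matrix (Fin h) (Fin m) ℝ) (b : Fin h → ℝ) (next : ReLUNet ι h) :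
      ReLUNet ι m

namespace ReLUNet

variable {ι : Type}

/-- The function realized by a network. -/
def eval : {m : ℕ} → ReLUNet ι m → (Fin m → ℝ) → (ι → ℝ)
  | _, last A b, x => A *ᵥ x + b
  | _, layer A b next, x => next.eval (fun i => relu ((A *ᵥ x + b) i))

/-- The depth: the number `J` of affine layers. -/
def depth : {m : ℕ} → ReLUNet ι m → ℕ
  | _, last _ _ => 1
  | _, layer _ _ next => next.depth + 1

/-- The largest of the dimensions `d_0, …, d_{J-1}` of the input layer and of the hidden layers. -/
def innerWidth : {m : ℕ} → ReLUNet ι m → ℕ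
  | m, last _ _ => m
  | m, layer _ _ next => max m next.innerWidth

/-- The number of nonzero entries of a weight matrix. -/
def matrixNonzeros {α β : Type} (A : Matrix α β ℝ) : ℕ :=
  {p : α × β | A p.1 p.2 ≠ 0}.ncard

/-- The number of nonzero entries of a bias vector. -/
def vectorNonzeros {α : Type} (b : α → ℝ) : ℕ :=
  {i : α | b i ≠ 0}.ncard

/-- The number of trainable parameters: the nonzero entries of all weights and biases. -/
def par : {m : ℕ} → ReLUNet ι m → ℕ
  | _, last A b => matrixNonzeros A + vectorNonzeros b
  | _, layer A b next => matrixNonzeros A + vectorNonzeros b + next.par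

end ReLUNet

/-- The softmax function on `ℝ^K`. -/
def softmax {K : ℕ} (w : Fin K → ℝ) (k : Fin K) : ℝ :=
  Real.exp (w k) / ∑ i, Real.exp (w i)

/-- The Gaussian probabilistic attention mechanism
`∑ k, softmax(w)_k N(m_k, S_kᵀ S_k)`, as a measure on `ℝ^D`. -/
def probAttention {K D : ℕ} (w : Fin K → ℝ) (m : Fin K → EuclideanSpace ℝ (Fin D))
    (S : Fin K → Matrix (Fin D) (Fin D) ℝ) : Measure (EuclideanSpace ℝ (Fin D)) :=
  ∑ k, ENNReal.ofReal (softmax w k) • multivariateGaussian (m k) ((S k)ᵀ * S k)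

/-- A probabilistic transformer on the metric space `X`, with values in measures on `ℝ^D`. The
outputs of the networks `gaussNet k` lie in `ℝ^D × ℝ^{D×D}`: the coordinates `Sum.inl i` form the
mean vector and the coordinates `Sum.inr (i, j)` form the square root of the covariance matrix. -/
structure ProbTransformer (X : Type*) [MetricSpace X] (D : ℕ) where
  /-- the number of landmarks -/
  L : ℕ
  L_pos : 0 < L
  /-- the number of mixture components -/
  K : ℕ
  K_pos : 0 < K
  landmark : Fin L → X
  weightNet : ReLUNet (Fin K) L
  gaussNet : Fin K → ReLUNet (Fin D ⊕ Fin D × Fin D) L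

namespace ProbTransformer

variable {X : Type*} [MetricSpace X] {D : ℕ}

/-- The un-normalized graph attention layer: the vector of distances to the landmarks. -/
def feature (T : ProbTransformer X D) (x : X) : Fin T.L → ℝ :=
  fun l => dist x (T.landmark l)

/-- The measure-valued map realized by a probabilistic transformer. -/
def eval (T : ProbTransformer X D) (x : X) : Measure (EuclideanSpace ℝ (Fin D)) :=
  probAttention (T.weightNet.eval (T.feature x))
    (fun k => WithLp.toLp 2 fun i => (T.gaussNet k).eval (T.feature x) (Sum.inl i))
    (fun k => Matrix.of fun i j => (T.gaussNet k).eval (T.feature x) (Sum.inr (i, j)))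

/-- The depth: the maximum of the depths of the constituent networks. -/
def depth (T : ProbTransformer X D) : ℕ :=
  max T.weightNet.depth (Finset.univ.sup fun k => (T.gaussNet k).depth)

/-- The width: the maximum of the widths of the constituent networks, the width of a network being
the largest dimension of its layers, input and output included. The output in `ℝ^D × ℝ^{D×D}` of
`gaussNet k` consists of two output vectors, of dimensions `D` and `D ^ 2`, each of which is
counted on its own. -/
def width (T : ProbTransformer X D) : ℕ :=
  max (max T.weightNet.innerWidth T.K)
    (Finset.univ.sup fun k => max (T.gaussNet k).innerWidth (max D (D ^ 2)))

/-- The effective dimension `K (D + D²)`. -/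
def effdim (T : ProbTransformer X D) : ℕ := T.K * (D + D ^ 2)

/-- The number of trainable parameters of all constituent networks. -/
def par (T : ProbTransformer X D) : ℕ :=
  T.weightNet.par + ∑ k, (T.gaussNet k).par

end ProbTransformer

/-- The aspect ratio of a finite metric space: the largest distance between two points over the
smallest distance between two distinct points. -/
def aspect (X : Type*) [MetricSpace X] : ℝ :=
  Metric.diam (Set.univ : Set X) / Set.infsep (Set.univ : Set X)

/-- The map `x ↦ (1/K) ∑ k, N_d(μ_k(x), 0)`. -/
def empiricalKernel {X : Type*} {d K : ℕ} (μ : Fin K → X → EuclideanSpace ℝ (Fin d)) (x : X) :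
    Measure (EuclideanSpace ℝ (Fin d)) :=
  (K : ℝ≥0∞)⁻¹ • ∑ k, multivariateGaussian (μ k x) 0

/-- The constant `C_n`. -/
def dimConst (n : ℕ) : ℝ :=
  (2 * Real.log (5 * √(2 * Real.pi)) + 3 / 2 * Real.log n - 1 / 2 * Real.log (n + 1)) /
    (2 * Real.log 2)

/-- The quantity
`√(n log n) [1 + (log 2 / log n) (C_n + log (n^{5/2} a) / log 2)_+]`, where `(u)_+ = max {u, 1}`. -/
def complexityFactor (n : ℕ) (a : ℝ) : ℝ :=
  √(n * Real.log n) *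
    (1 + Real.log 2 / Real.log n *
      max (dimConst n + Real.log ((n : ℝ) ^ (5 / 2 : ℝ) * a) / Real.log 2) 1)

end

/-! Take every point of the space as a landmark and let `δ` be the least distance between distinct
points. The feature vector of the `k`-th point vanishes at coordinate `k` and is at least `δ`
elsewhere, so one hidden layer of bumps `max 0 (1 - t l / δ)` sends it to the `k`-th basis vector
(`relu_bump`), from which a linear layer reads off any prescribed value (`memorizer_eval`). Zero
logits give uniform weights and a zero square root gives point masses, so `φ` is reproduced exactly
at depth 2. Dead neurons pad the hidden layer to the exact width at no cost in parameters
(`memorizer_par_le`). -/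

/-- The first layer of `memorizer`: neuron `l < n` has weight `-δ⁻¹` on the feature `l`. -/
noncomputable def bumpWeight (n H : ℕ) (δ : ℝ) : Matrix (Fin H) (Fin n) ℝ :=
  Matrix.of fun i l => if (i : ℕ) = l then -δ⁻¹ else 0

/-- The bias of the first layer of `memorizer`. -/
noncomputable def bumpBias (n H : ℕ) : Fin H → ℝ := fun i => if (i : ℕ) < n then 1 else 0

/-- The last layer of `memorizer`: neuron `l < n` carries the value to be read off at point `l`. -/
noncomputable def readout {ι : Type} {n : ℕ} (H : ℕ) (y : Fin n → ι → ℝ) : Matrix ι (Fin H) ℝ :=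
  Matrix.of fun j i => if h : (i : ℕ) < n then y ⟨i, h⟩ j else 0

/-- The network with one hidden layer of dimension `H`, whose neuron `l < n` is
`t ↦ max 0 (1 - t l / δ)` and whose output is the combination of the `y l` with these weights. -/
noncomputable def memorizer {ι : Type} {n : ℕ} (H : ℕ) (δ : ℝ) (y : Fin n → ι → ℝ) : ReLUNet ι n :=
  .layer (bumpWeight n H δ) (bumpBias n H) (.last (readout H y) 0)

theorem relu_bump {n H : ℕ} {δ : ℝ} (hδ : 0 < δ) {t : Fin n → ℝ} {k : Fin n}
    (hk : t k = 0) (ht : ∀ l, l ≠ k → δ ≤ t l) (i : Fin H) :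
    relu ((bumpWeight n H δ *ᵥ t + bumpBias n H) i) = if (i : ℕ) = k then 1 else 0 := by
  by_cases hi : (i : ℕ) < n
  · have hsum : (bumpWeight n H δ *ᵥ t) i = -δ⁻¹ * t ⟨i, hi⟩ := by
      simp only [Matrix.mulVec, dotProduct, bumpWeight, Matrix.of_apply]
      rw [Finset.sum_eq_single ⟨i, hi⟩]
      · simp
      · intro l _ hl
        rw [if_neg fun h => hl (Fin.ext h.symm), zero_mul]
      · simp
    rw [Pi.add_apply, hsum, bumpBias, if_pos hi]
    by_cases hik : (i : ℕ) = k
    · simp [hk, hik, relu]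
    · have h1 : δ ≤ t ⟨i, hi⟩ := ht _ fun h => hik (congrArg Fin.val h)
      have h2 : 1 ≤ δ⁻¹ * t ⟨i, hi⟩ := by
        rw [← inv_mul_cancel₀ hδ.ne']
        gcongr
      rw [if_neg hik, relu, max_eq_left]
      linarith
  · have hik : (i : ℕ) ≠ k := fun h => hi (h ▸ k.2)
    have hne : ∀ l : Fin n, (i : ℕ) ≠ l := fun l h => hi (h ▸ l.2)
    simp [Matrix.mulVec, dotProduct, bumpWeight, bumpBias, relu, hi, hik, hne]

theorem memorizer_eval {ι : Type} {n H : ℕ} (hH : n ≤ H) {δ : ℝ} (hδ : 0 < δ)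
    (y : Fin n → ι → ℝ) {t : Fin n → ℝ} {k : Fin n}
    (hk : t k = 0) (ht : ∀ l, l ≠ k → δ ≤ t l) : (memorizer H δ y).eval t = y k := by
  funext j
  simp only [memorizer, ReLUNet.eval, relu_bump hδ hk ht, add_zero, Matrix.mulVec, dotProduct,
    readout, Matrix.of_apply]
  rw [Finset.sum_eq_single (Fin.castLE hH k)]
  · simp
  · intro i _ hi
    rw [if_neg fun h : (i : ℕ) = k => hi (Fin.ext h), mul_zero]
  · simp

/-- The `n` bumps use one weight and one bias each, and the readout at most `s.card` weights per
bump. The bound is free of `H` because padding neurons have only zero entries. -/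
theorem memorizer_par_le {ι : Type} [Finite ι] {n : ℕ} (H : ℕ) (δ : ℝ) (y : Fin n → ι → ℝ)
    (s : Finset ι) (hs : ∀ l, ∀ j ∉ s, y l j = 0) :
    (memorizer H δ y).par ≤ (2 + s.card) * n := by
  have ncard_le {α : Type} [Finite α] (u : Set α) (f : α → ℕ) (hf : Set.InjOn f u)
      (hu : ∀ a ∈ u, f a < n) : u.ncard ≤ n := by
    have := Set.ncard_le_ncard_of_injOn f (t := Set.Iio n) hu hf (Set.finite_Iio n)
    simpa [Set.ncard_eq_toFinset_card'] using this
  have h1 : ReLUNet.matrixNonzeros (bumpWeight n H δ) ≤ n := by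
    have key : ∀ p : Fin H × Fin n, bumpWeight n H δ p.1 p.2 ≠ 0 → (p.1 : ℕ) = p.2 := by
      intro p hp
      by_contra h
      exact hp (by simp [bumpWeight, h])
    refine ncard_le _ (fun p => p.2) ?_ fun p _ => p.2.2
    intro p hp q hq hpq
    exact Prod.ext (Fin.ext ((key p hp).trans (hpq.trans (key q hq).symm))) (Fin.ext hpq)
  have h2 : ReLUNet.vectorNonzeros (bumpBias n H) ≤ n := by
    refine ncard_le _ (fun i => i) Fin.val_injective.injOn fun i hi => ?_
    by_contra h
    exact hi (by simp [bumpBias, h])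
  have h3 : ReLUNet.matrixNonzeros (readout H y) ≤ s.card * n := by
    have := Set.ncard_le_ncard_of_injOn (fun p : ι × Fin H => (p.1, (p.2 : ℕ)))
      (s := {p | readout H y p.1 p.2 ≠ 0}) (t := ↑(s ×ˢ Finset.range n)) ?_ ?_
      (Finset.finite_toSet _)
    · rwa [Set.ncard_coe_finset, Finset.card_product, Finset.card_range] at this
    · rintro ⟨j, i⟩ hp
      simp only [Set.mem_ofPred_eq, readout, Matrix.of_apply] at hp
      have hi : (i : ℕ) < n := by
        by_contra h
        exact hp (dif_neg h)
      rw [dif_pos hi] at hp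
      have hj : j ∈ s := by
        by_contra h
        exact hp (hs _ j h)
      simp [hi, hj]
    · rintro ⟨j, i⟩ _ ⟨j', i'⟩ _ h
      simpa [Fin.ext_iff] using h
  have h4 : ReLUNet.vectorNonzeros (0 : ι → ℝ) = 0 := by simp [ReLUNet.vectorNonzeros]
  simp only [memorizer, ReLUNet.par, h4]
  linarith

/-- This sign is all that the final bounds need to know about `F`. -/
theorem complexityFactor_nonneg (n : ℕ) (a : ℝ) : 0 ≤ complexityFactor n a := by
  have : 0 ≤ Real.log 2 / Real.log n := div_nonneg (by positivity) (Real.log_natCast_nonneg n)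
  unfold complexityFactor
  positivity

theorem probAttention_zero_eq_empiricalKernel {X : Type*} {d K : ℕ}
    (μ : Fin K → X → EuclideanSpace ℝ (Fin d)) (x : X) (hK : 0 < K) :
    probAttention (0 : Fin K → ℝ) (fun k => μ k x) (fun _ => 0) = empiricalKernel μ x := by
  have h : ENNReal.ofReal (K : ℝ)⁻¹ = (K : ℝ≥0∞)⁻¹ := by
    rw [ENNReal.ofReal_inv_of_pos (by exact_mod_cast hK), ENNReal.ofReal_natCast]
  simp [probAttention, empiricalKernel, softmax, Finset.smul_sum, h]

/-- The transformer with uniform mixture weights whose landmarks are all the points of the space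
and whose Gaussian networks memorize the point masses at `μ k x`. -/
noncomputable def memorizingTransformer {X : Type*} [MetricSpace X] {n d K : ℕ} (hn : 0 < n) (hK : 0 < K)
    (H : ℕ) (e : Fin n ≃ X) (μ : Fin K → X → EuclideanSpace ℝ (Fin d)) : ProbTransformer X d where
  L := n
  L_pos := hn
  K := K
  K_pos := hK
  landmark := e
  weightNet := .last 0 0
  gaussNet k := memorizer H (Set.univ : Set X).infsep fun l => Sum.elim (μ k (e l)) (0 : Fin d × Fin d → ℝ)

section memorizingTransformer

variable {X : Type*} [MetricSpace X] {n d K : ℕ} (hn : 0 < n) (hK : 0 < K) {H : ℕ} (e : Fin n ≃ X)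
  (μ : Fin K → X → EuclideanSpace ℝ (Fin d))

theorem memorizingTransformer_eval [Finite X] [Nontrivial X] (hH : n ≤ H) (x : X) :
    (memorizingTransformer hn hK H e μ).eval x = empiricalKernel μ x := by
  -- On a one-point space `infsep` would be `0`, hence the nontriviality.
  have hδ : 0 < (Set.univ : Set X).infsep :=
    Set.finite_univ.infsep_pos_iff_nontrivial.2 Set.nontrivial_univ
  have key (k : Fin K) :
      (memorizer H (Set.univ : Set X).infsep fun l => Sum.elim (μ k (e l)) (0 : Fin d × Fin d → ℝ)).eval
        (fun l => dist x (e l)) = Sum.elim (μ k x) (0 : Fin d × Fin d → ℝ) := by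
    rw [memorizer_eval (k := e.symm x) hH hδ _ (by simp), e.apply_symm_apply]
    intro l hl
    exact Set.infsep_le_dist_of_mem (Set.mem_univ _) (Set.mem_univ _) fun h => hl (by simp [h])
  rw [← probAttention_zero_eq_empiricalKernel μ x hK]
  change probAttention ((ReLUNet.last 0 0).eval _) (fun k => WithLp.toLp 2 fun i =>
    (memorizer H _ _).eval _ (Sum.inl i)) (fun k => Matrix.of fun i j =>
      (memorizer H _ _).eval _ (Sum.inr (i, j))) = _
  congr 1
  · simp only [ReLUNet.eval, Matrix.zero_mulVec, add_zero]
    rfl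
  · funext k
    exact congrArg (fun v => WithLp.toLp 2 fun i => v (Sum.inl i)) (key k)
  · funext k
    exact congrArg (fun v => Matrix.of fun i j => v (Sum.inr (i, j))) (key k)

theorem memorizingTransformer_width (hH : n ≤ H) :
    (memorizingTransformer hn hK H e μ).width = max (max n K) (max (d ^ 2) H) := by
  -- A supremum over an empty index set would be `0`, not the common value.
  have : Nonempty (Fin K) := ⟨⟨0, hK⟩⟩
  simp only [ProbTransformer.width, memorizingTransformer, memorizer, ReLUNet.innerWidth,
    max_eq_right hH, max_eq_right (Nat.le_self_pow two_ne_zero d)]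
  rw [max_comm (d ^ 2)]
  exact congrArg _ (Finset.sup_const (Finset.univ_nonempty (α := Fin K)) _)

theorem memorizingTransformer_depth : (memorizingTransformer hn hK H e μ).depth = 2 := by
  have : Nonempty (Fin K) := ⟨⟨0, hK⟩⟩
  simp only [ProbTransformer.depth, memorizingTransformer, memorizer, ReLUNet.depth]
  exact congrArg _ (Finset.sup_const (Finset.univ_nonempty (α := Fin K)) 2)

theorem memorizingTransformer_par_le :
    (memorizingTransformer hn hK H e μ).par ≤ K * ((2 + d) * n) := by
  have h0 : (ReLUNet.last (0 : Matrix (Fin K) (Fin n) ℝ) 0).par = 0 := by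
    simp [ReLUNet.par, ReLUNet.matrixNonzeros, ReLUNet.vectorNonzeros]
  have hk (k : Fin K) :
      (memorizer H (Set.univ : Set X).infsep fun l => Sum.elim (μ k (e l)) (0 : Fin d × Fin d → ℝ)).par ≤
        (2 + d) * n := by
    -- Only the `d` mean coordinates can be nonzero; the covariance block is free.
    refine (memorizer_par_le H _ _ (Finset.univ.map .inl) fun l j hj => ?_).trans_eq (by simp)
    cases j with
    | inl i => simp at hj
    | inr p => rfl
  calc (memorizingTransformer hn hK H e μ).par
      = ∑ k : Fin K,
          (memorizer H (Set.univ : Set X).infsep fun l => Sum.elim (μ k (e l)) (0 : Fin d × Fin d → ℝ)).par := by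
        simp only [ProbTransformer.par, memorizingTransformer, h0, zero_add]
        rfl
    _ ≤ ∑ _k : Fin K, (2 + d) * n := Finset.sum_le_sum fun k _ => hk k
    _ = K * ((2 + d) * n) := by simp

end memorizingTransformer

theorem mainTheorem10 :
    ∃ C : ℝ, 0 < C ∧
      ∀ (n d K : ℕ), 2 < n → 0 < d → 0 < K →
      ∀ (X : Type*) [MetricSpace X] [Fintype X], Fintype.card X = n →
      ∀ μ : Fin K → X → EuclideanSpace ℝ (Fin d),
        ∃ T : ProbTransformer X d,
          (∀ x : X, T.eval x = empiricalKernel μ x) ∧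
          T.width = max (max n K) (max (d ^ 2) (n * (n - 1) + max d 12)) ∧
          (T.depth : ℝ) ≤ C * (n * (1 + complexityFactor n (aspect X))) ∧
          T.effdim ≤ K * (d + d ^ 2) ∧
          (T.par : ℝ) ≤
            C * (K * n * (11 / 4 * max (n : ℝ) d * (n : ℝ) ^ 2 - 1) *
              (d + max (d : ℝ) 12 ^ 2 * complexityFactor n (aspect X))) := by
  -- The constant 3 comes from `2 + d ≤ 3 * d`; it also covers depth 2.
  refine ⟨3, by norm_num, fun n d K hn hd hK X _ _ hX μ => ?_⟩
  have hn0 : 0 < n := by omega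
  have : Nontrivial X := Fintype.one_lt_card_iff_nontrivial.1 (by omega)
  have hH : n ≤ n * (n - 1) + max d 12 :=
    (Nat.le_mul_of_pos_right n (by omega)).trans (Nat.le_add_right _ _)
  have hF := complexityFactor_nonneg n (aspect X)
  have hn' : (2 : ℝ) < n := by exact_mod_cast hn
  have hd' : (1 : ℝ) ≤ d := by exact_mod_cast hd
  let e : Fin n ≃ X := (Fintype.equivFinOfCardEq hX).symm
  -- This hidden dimension is chosen to give equality in the width.
  refine ⟨memorizingTransformer hn0 hK (n * (n - 1) + max d 12) e μ,
    memorizingTransformer_eval hn0 hK e μ hH, memorizingTransformer_width hn0 hK e μ hH,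
    ?_, le_rfl, ?_⟩
  · rw [memorizingTransformer_depth]
    push_cast
    nlinarith
  · have hfac : (1 : ℝ) ≤ 11 / 4 * max (n : ℝ) d * (n : ℝ) ^ 2 - 1 := by
      have h1 : (2 : ℝ) ≤ max (n : ℝ) d := le_max_of_le_left hn'.le
      have h2 : (4 : ℝ) ≤ (n : ℝ) ^ 2 := by nlinarith
      nlinarith
    have hsum : (d : ℝ) ≤ d + max (d : ℝ) 12 ^ 2 * complexityFactor n (aspect X) :=
      le_add_of_nonneg_right (by positivity)
    calc ((memorizingTransformer hn0 hK (n * (n - 1) + max d 12) e μ).par : ℝ)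
        ≤ K * ((2 + d) * n) := by exact_mod_cast memorizingTransformer_par_le hn0 hK e μ
      _ ≤ K * ((3 * d) * n) := by gcongr; linarith
      _ = 3 * (K * n * 1 * d) := by ring
      _ ≤ _ := by gcongr
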